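/- **Setting.** Let $(V_i,\varepsilon_i)$, $i\ge 1$, be the features and noise of the unlabeled units, $f$ a measurable real function, $X_i=f(V_i)$ (unobserved) and $Y_i=X_i\beta+\varepsilon_i$. Labeled data of size $n_l=n_t+n_{tr}$ are split into $n_t$ test and $n_{tr}$ training points with $n_t/n_l\to\psi\in(0,1)$. For each training size $n_{tr}\ge1$ there are $M$ models; model $j$ predicts $\widehat X_i^{(j)}=f(V_i)+e_{j,i}$ for unit $i$, and the tuples $(V_i,\varepsilon_i,\widehat X^{(1)}_i,\dots,\widehat X^{(M)}_i)$ are i.i.d. over $i$. All of the variables $\varepsilon_i, e_{j,i}$ have finite second moments. Assume: * $|f(V)|\le C_1$ almost surely, and $E[f(V)]\neq0$; * $E[e_j\mid V]=0$; $E[e_j^2\mid V]=C_2^{(j)}n_{tr}^{-\gamma}$ with $\gamma>0$; and, for $j\ne k$, $E[e_je_k\mid V]=C_3^{(j,k)}n_{tr}^{-\nu}$ with $\nu\ge\gamma$, where the $C_2^{(j)}$, $C_3^{(j,k)}$ are constants; * (I) $E[\varepsilon\mid X]=0$; (II) $E[\varepsilon e_j\mid X]=0$ for all $j$; (III) $E[\varepsilon^2\mid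 X]=\sigma_\varepsilon^2$, a finite constant. Fix two distinct models $a\neq b$, let $\widehat X=\widehat X^{(a)}$ be the mismeasured covariate and $Z=\widehat X^{(b)}$ the instrument, and assume that the squares of $e_be_a$ and of $e_b\varepsilon$ are uniformly integrable over $n_{tr}\ge1$ (this holds, for instance, if the predictions are uniformly bounded). Let $u=Y-\widehat X\beta=\varepsilon-e_a\beta$ and $$\hat\beta_{IV}=\Big(\tfrac1{n_u}\sum_{i=1}^{n_u}Z_i\widehat X_i\Big)^{-1}\Big(\tfrac1{n_u}\sum_{i=1}^{n_u}Z_iY_i\Big),\qquad \overline{f^2}=\tfrac1{n_u}\sum_{i=1}^{n_u}f(V_i)^2 .$$ **Theorem.** Let $n_u,n_l\to\infty$ along any sequence along which the instrument asymptotically meets the exclusion condition $\mathrm{Cov}(Z,u)=0$, in the sense that $\sqrt{n_u}\,\mathrm{Cov}(Z,u)\to0$. Then $\sqrt{n_u}(\hat\beta_{IV}-\beta)$ is asymptotically $\mathcal N(0,\sigma_\varepsilon^2/\overline{f^2})$. Precisely, $E[f(V)^2]>0$, $\overline{f^2}\to E[f(V)^2]$ almost surely, and $$\sqrt{n_u}\,(\hat\beta_{IV}-\beta)\rightsquigarrow\mathcal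 N\Big(0,\frac{\sigma_\varepsilon^2}{E[f(V)^2]}\Big),\qquad \sqrt{\overline{f^2}}\,\sqrt{n_u}\,(\hat\beta_{IV}-\beta)\rightsquigarrow\mathcal N(0,\sigma_\varepsilon^2).$$ -/

import Mathlib

open MeasureTheory ProbabilityTheory Filter Topology

namespace EnsembleIV

noncomputable section

variable {Ω 𝒱 : Type*}

/-- The variable of interest `X i = f (V i)`; it is unobserved in the unlabeled data. -/
def trueVar (f : 𝒱 → ℝ) (V : ℕ → Ω → 𝒱) (i : ℕ) (ω : Ω) : ℝ := f (V i ω)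

/-- The outcome `Y i = X i * β + ε i`. -/
def outcome (f : 𝒱 → ℝ) (V : ℕ → Ω → 𝒱) (β : ℝ) (ε : ℕ → Ω → ℝ) (i : ℕ) (ω : Ω) : ℝ :=
  trueVar f V i ω * β + ε i ω

/-- The prediction error `e = prediction - X` on the `i`-th unit, for predictions `xhat`. -/
def predError (f : 𝒱 → ℝ) (V : ℕ → Ω → 𝒱) (xhat : ℕ → Ω → ℝ) (i : ℕ) (ω : Ω) : ℝ :=
  xhat i ω - trueVar f V i ω

/-- The error `u = Y - xhat * β` of the regression of `Y` on the predictions `xhat`. -/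
def regError (f : 𝒱 → ℝ) (V : ℕ → Ω → 𝒱) (β : ℝ) (ε : ℕ → Ω → ℝ) (xhat : ℕ → Ω → ℝ)
    (i : ℕ) (ω : Ω) : ℝ :=
  outcome f V β ε i ω - xhat i ω * β

/-- The instrumental variable estimator computed from the first `n` units. -/
def ivEstimator (n : ℕ) (z xhat y : ℕ → Ω → ℝ) (ω : Ω) : ℝ :=
  ((n : ℝ)⁻¹ * ∑ i ∈ Finset.range n, z i ω * xhat i ω)⁻¹ *
    ((n : ℝ)⁻¹ * ∑ i ∈ Finset.range n, z i ω * y i ω)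

/-- The empirical second moment of `X = f (V)` over the first `n` units. -/
def sampleSecondMoment (f : 𝒱 → ℝ) (V : ℕ → Ω → 𝒱) (n : ℕ) (ω : Ω) : ℝ :=
  (n : ℝ)⁻¹ * ∑ i ∈ Finset.range n, f (V i ω) ^ 2

/-- The standing assumptions. Units of the unlabeled data are indexed by `i`, and
`pred m j i` is the prediction of the `j`-th model, trained on `m` observations, for unit `i`. -/
structure Assumptions [MeasurableSpace Ω] [MeasurableSpace 𝒱] (P : Measure Ω) {M : ℕ}
    (f : 𝒱 → ℝ) (V : ℕ → Ω → 𝒱) (ε : ℕ → Ω → ℝ) (pred : ℕ → Fin M → ℕ → Ω → ℝ)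
    (γ ν σsq : ℝ) : Prop where
  /-- All objects are measurable. -/
  measurable_f : Measurable f
  measurable_V : ∀ i, Measurable (V i)
  measurable_ε : ∀ i, Measurable (ε i)
  measurable_pred : ∀ m j i, Measurable (pred m j i)
  /-- The units, with the predictions made for them, are drawn i.i.d. -/
  indep : ∀ m, 1 ≤ m → iIndepFun (fun i ω => (V i ω, ε i ω, fun j => pred m j i ω)) P
  identDistrib : ∀ m, 1 ≤ m → ∀ i,
    IdentDistrib (fun ω => (V i ω, ε i ω, fun j => pred m j i ω))
      (fun ω => (V 0 ω, ε 0 ω, fun j => pred m j 0 ω)) P P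
  /-- `X = f (V)` is bounded. -/
  bounded_f : ∃ C₁ : ℝ, ∀ i, ∀ᵐ ω ∂P, |f (V i ω)| ≤ C₁
  /-- `X = f (V)` has nonzero mean. -/
  mean_ne_zero : ∫ ω, f (V 0 ω) ∂P ≠ 0
  /-- The moments in the remaining conditions exist. -/
  memLp_ε : ∀ i, MemLp (ε i) 2 P
  memLp_error : ∀ m, 1 ≤ m → ∀ j i, MemLp (predError f V (pred m j) i) 2 P
  /-- Prediction errors are centered given the features. -/
  error_mean : ∀ m, 1 ≤ m → ∀ j i,
    P[predError f V (pred m j) i | MeasurableSpace.comap (V i) inferInstance] =ᵐ[P] 0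
  /-- The conditional variances of the prediction errors are of order `m ^ (-γ)`. -/
  gamma_pos : 0 < γ
  error_var : ∃ C₂ : Fin M → ℝ, ∀ m, 1 ≤ m → ∀ j i,
    P[fun ω => predError f V (pred m j) i ω ^ 2 | MeasurableSpace.comap (V i) inferInstance]
      =ᵐ[P] fun _ => C₂ j / (m : ℝ) ^ γ
  /-- The conditional covariances of distinct models are of order `m ^ (-ν)`. -/
  gamma_le_nu : γ ≤ ν
  error_cov : ∃ C₃ : Fin M → Fin M → ℝ, ∀ m, 1 ≤ m → ∀ j k, j ≠ k → ∀ i,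
    P[fun ω => predError f V (pred m j) i ω * predError f V (pred m k) i ω |
        MeasurableSpace.comap (V i) inferInstance]
      =ᵐ[P] fun _ => C₃ j k / (m : ℝ) ^ ν
  /-- Mean independence: `E[ε | X] = 0`. -/
  noise_mean : ∀ i,
    P[ε i | MeasurableSpace.comap (trueVar f V i) inferInstance] =ᵐ[P] 0
  /-- No direct effect on the outcome: `E[ε * e | X] = 0` for the errors `e` of all models. -/
  noise_mul_error_mean : ∀ m, 1 ≤ m → ∀ j i,
    P[fun ω => ε i ω * predError f V (pred m j) i ω |
        MeasurableSpace.comap (trueVar f V i) inferInstance] =ᵐ[P] 0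
  /-- Homoscedasticity: `E[ε ^ 2 | X]` is the constant `σsq`. -/
  noise_sq_mean : ∀ i,
    P[fun ω => ε i ω ^ 2 | MeasurableSpace.comap (trueVar f V i) inferInstance]
      =ᵐ[P] fun _ => σsq

end

end EnsembleIV

/-! Write `Z = f + e_b` and `u = ε - β e_a`. Then `Z u = f ε + R` with `R = e_b ε - β f e_a - β e_b
e_a`, and `Z * xhat = f² + D`, where every term of `D` contains a prediction error. The scaled
estimation error is the normalized sum of `Z u` divided by the sample mean of `Z * xhat`.

The sum of `f ε` obeys the classical central limit theorem, with variance `σsq * E[f²]` by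
homoscedasticity. The errors vanish in `L²` because `γ > 0` and the training size diverges; their
products vanish in `L¹` by Hölder, and in `L²` by uniform integrability, so `R` and `D` vanish in
`L²`. Since `E[u] = 0` and `E[f ε] = 0`, the mean of `R` is exactly `Cov(Z, u)`, so the exclusion
condition controls the bias of the normalized sum of `R`, while its variance is at most `E[R²]`
(`tendstoInMeasure_inv_sqrt_mul_sum_zero`). The denominator tends to `E[f²] > 0`
(`tendstoInMeasure_sampleMean_mul`), and Slutsky's theorem gives variance `σsq * E[f²] / E[f²]²`. A
second use of Slutsky studentizes the result. -/

namespace EnsembleIV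

/-! ### Convergence in `L²`, in probability and in distribution. -/

section Convergence

variable {Ω : Type*} {mΩ : MeasurableSpace Ω} {P : Measure Ω}

/-- If `E[Y | 𝓖]` is the constant `c`, then `E[X Y] = c E[X]` for `𝓖`-measurable `X`. -/
lemma integral_mul_of_condExp_eq_const [IsFiniteMeasure P] {m : MeasurableSpace Ω}
    (hm : m ≤ mΩ) {X Y : Ω → ℝ} {c : ℝ} (hX : StronglyMeasurable[m] X)
    (hXY : Integrable (X * Y) P) (hY : Integrable Y P) (h : P[Y | m] =ᵐ[P] fun _ => c) :
    ∫ ω, X ω * Y ω ∂P = c * ∫ ω, X ω ∂P := by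
  have h1 : ∫ ω, X ω * Y ω ∂P = ∫ ω, (P[X * Y | m]) ω ∂P := (integral_condExp hm).symm
  rw [h1, ← integral_const_mul]
  refine integral_congr_ae ?_
  filter_upwards [condExp_mul_of_stronglyMeasurable_left hX hXY hY, h] with ω h2 h3
  rw [h2, Pi.mul_apply, h3, mul_comm]

lemma integral_eq_of_condExp_eq_const [IsProbabilityMeasure P] {m : MeasurableSpace Ω}
    (hm : m ≤ mΩ) {Y : Ω → ℝ} {c : ℝ} (h : P[Y | m] =ᵐ[P] fun _ => c) :
    ∫ ω, Y ω ∂P = c := by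
  rw [← integral_condExp hm, integral_congr_ae h]
  simp

lemma tendsto_integral_sq_of_tendsto_eLpNorm {X : ℕ → Ω → ℝ} (hX : ∀ k, MemLp (X k) 2 P)
    (h : Tendsto (fun k => eLpNorm (X k) 2 P) atTop (𝓝 0)) :
    Tendsto (fun k => ∫ ω, X k ω ^ 2 ∂P) atTop (𝓝 0) := by
  have h1 : ∀ k, ∫ ω, X k ω ^ 2 ∂P = (eLpNorm (X k) 2 P).toReal ^ 2 := by
    intro k
    rw [(hX k).eLpNorm_eq_integral_rpow_norm (by norm_num) (by norm_num),
      ENNReal.toReal_ofReal (by positivity)]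
    have h0 : 0 ≤ ∫ ω, X k ω ^ 2 ∂P := integral_nonneg fun ω => sq_nonneg _
    simp only [ENNReal.toReal_ofNat, Real.rpow_two, Real.norm_eq_abs, sq_abs]
    rw [← Real.rpow_natCast, ← Real.rpow_mul h0]
    norm_num
  simp_rw [h1]
  have := (ENNReal.tendsto_toReal ENNReal.zero_ne_top).comp h
  simpa using this.pow 2

lemma tendsto_eLpNorm_of_tendsto_integral_sq {X : ℕ → Ω → ℝ} (hX : ∀ k, MemLp (X k) 2 P)
    (h : Tendsto (fun k => ∫ ω, X k ω ^ 2 ∂P) atTop (𝓝 0)) :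
    Tendsto (fun k => eLpNorm (X k) 2 P) atTop (𝓝 0) := by
  have h1 : ∀ k, eLpNorm (X k) 2 P = ENNReal.ofReal (√(∫ ω, X k ω ^ 2 ∂P)) := by
    intro k
    rw [(hX k).eLpNorm_eq_integral_rpow_norm (by norm_num) (by norm_num), Real.sqrt_eq_rpow]
    simp
  simp_rw [h1]
  have := ENNReal.tendsto_ofReal ((Real.continuous_sqrt.tendsto 0).comp h)
  simpa using this

/-- A product that vanishes in `L¹` by Hölder's inequality and has uniformly integrable square
vanishes in `L²`. -/
lemma tendsto_eLpNorm_mul_of_unifIntegrable [IsFiniteMeasure P] {X Y : ℕ → Ω → ℝ}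
    (hX : ∀ k, AEStronglyMeasurable (X k) P) (hY : ∀ k, AEStronglyMeasurable (Y k) P)
    (hXY : Tendsto (fun k => eLpNorm (X k) 2 P * eLpNorm (Y k) 2 P) atTop (𝓝 0))
    (hUI : UnifIntegrable (fun k ω => X k ω * Y k ω) 2 P) :
    Tendsto (fun k => eLpNorm (fun ω => X k ω * Y k ω) 2 P) atTop (𝓝 0) := by
  have hmeas : ∀ k, AEStronglyMeasurable (fun ω => X k ω * Y k ω) P := fun k => (hX k).mul (hY k)
  have h1 : Tendsto (fun k => eLpNorm (fun ω => X k ω * Y k ω) 1 P) atTop (𝓝 0) :=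
    tendsto_of_tendsto_of_tendsto_of_le_of_le tendsto_const_nhds hXY (fun _ => zero_le)
      fun k => by
        simpa using eLpNorm_le_eLpNorm_mul_eLpNorm_of_nnnorm (p := 2) (q := 2) (r := 1) (hX k)
          (hY k) (fun x y : ℝ => x * y) 1 (by simp)
  have h2 : TendstoInMeasure P (fun k ω => X k ω * Y k ω) atTop (0 : Ω → ℝ) :=
    tendstoInMeasure_of_tendsto_eLpNorm one_ne_zero hmeas aestronglyMeasurable_zero
      (by simpa using h1)
  -- Vitali's theorem upgrades convergence in probability to `L²`.
  simpa using tendsto_Lp_finite_of_tendstoInMeasure (by norm_num) (by norm_num) hmeas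
    (MemLp.zero : MemLp (0 : Ω → ℝ) 2 P) hUI h2

/-- Sample means of a triangular array vanish in probability if its rows vanish in `L¹`. -/
lemma tendstoInMeasure_sampleMean_zero {X : ℕ → ℕ → Ω → ℝ} {n : ℕ → ℕ}
    (hX : ∀ k i, AEStronglyMeasurable (X k i) P)
    (hident : ∀ k i, eLpNorm (X k i) 1 P = eLpNorm (X k 0) 1 P)
    (h : Tendsto (fun k => eLpNorm (X k 0) 1 P) atTop (𝓝 0)) :
    TendstoInMeasure P (fun k ω => (n k : ℝ)⁻¹ * ∑ i ∈ Finset.range (n k), X k i ω) atTop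
      (0 : Ω → ℝ) := by
  have hmeas : ∀ k, AEStronglyMeasurable (∑ i ∈ Finset.range (n k), X k i) P := fun k =>
    Finset.aestronglyMeasurable_sum _ fun i _ => hX k i
  have heq : (fun k ω => (n k : ℝ)⁻¹ * ∑ i ∈ Finset.range (n k), X k i ω)
      = fun k => (n k : ℝ)⁻¹ • ∑ i ∈ Finset.range (n k), X k i := by
    ext k ω; simp
  rw [heq]
  refine tendstoInMeasure_of_tendsto_eLpNorm one_ne_zero (fun k => (hmeas k).const_smul _)
    aestronglyMeasurable_zero ?_
  refine tendsto_of_tendsto_of_tendsto_of_le_of_le tendsto_const_nhds h (fun _ => zero_le)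
    fun k => ?_
  simp only [sub_zero]
  rw [eLpNorm_const_smul]
  calc ‖(n k : ℝ)⁻¹‖ₑ * eLpNorm (∑ i ∈ Finset.range (n k), X k i) 1 P
      ≤ ‖(n k : ℝ)⁻¹‖ₑ * ∑ i ∈ Finset.range (n k), eLpNorm (X k i) 1 P := by
        gcongr
        exact eLpNorm_sum_le (fun i _ => hX k i) le_rfl
    _ = (‖(n k : ℝ)⁻¹‖ₑ * ‖(n k : ℝ)‖ₑ) * eLpNorm (X k 0) 1 P := by
        simp [hident, mul_assoc]
    -- Only an inequality, because the factor is `0` when `n k = 0`.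
    _ ≤ 1 * eLpNorm (X k 0) 1 P := by
        gcongr
        rw [← enorm_mul]
        by_cases hn : (n k : ℝ) = 0
        · simp [hn]
        · simp [inv_mul_cancel₀ hn]
    _ = _ := one_mul _

/-- Normalized sums of a triangular array with i.i.d. rows vanish in probability if the rows
vanish in `L²` and their means are negligible at the scale of the normalization. -/
lemma tendstoInMeasure_inv_sqrt_mul_sum_zero [IsProbabilityMeasure P] {X : ℕ → ℕ → Ω → ℝ}
    {n : ℕ → ℕ} (hX : ∀ k, MemLp (X k 0) 2 P) (hindep : ∀ k, iIndepFun (X k) P)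
    (hident : ∀ k i, IdentDistrib (X k i) (X k 0) P P)
    (h : Tendsto (fun k => eLpNorm (X k 0) 2 P) atTop (𝓝 0))
    (hmean : Tendsto (fun k => √(n k : ℝ) * ∫ ω, X k 0 ω ∂P) atTop (𝓝 0)) :
    TendstoInMeasure P (fun k ω => (√(n k : ℝ))⁻¹ * ∑ i ∈ Finset.range (n k), X k i ω) atTop
      (0 : Ω → ℝ) := by
  have hXi : ∀ k i, MemLp (X k i) 2 P := fun k i => (hident k i).memLp_iff.2 (hX k)
  set S : ℕ → Ω → ℝ := fun k ω => (√(n k : ℝ))⁻¹ * ∑ i ∈ Finset.range (n k), X k i ω with hS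
  have hSL : ∀ k, MemLp (S k) 2 P := fun k =>
    (memLp_finsetSum _ fun i _ => hXi k i).const_mul _
  have hsum : ∀ k, MemLp (∑ i ∈ Finset.range (n k), X k i) 2 P := fun k =>
    memLp_finsetSum' _ fun i _ => hXi k i
  have hSmean : ∀ k, ∫ ω, S k ω ∂P = √(n k : ℝ) * ∫ ω, X k 0 ω ∂P := by
    intro k
    simp only [hS]
    rw [integral_const_mul, integral_finsetSum _ fun i _ => (hXi k i).integrable (by norm_num)]
    simp only [(hident k _).integral_eq, Finset.sum_const, Finset.card_range, nsmul_eq_mul]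
    rw [← mul_assoc, inv_mul_eq_div, Real.div_sqrt]
  -- Independence within a row makes the variance of the normalized sum that of a single term, or
  -- `0` when `n k = 0`.
  have hSvar : ∀ k, Var[S k; P] ≤ ∫ ω, X k 0 ω ^ 2 ∂P := by
    intro k
    have h0 : S k = fun ω => (√(n k : ℝ))⁻¹ * (∑ i ∈ Finset.range (n k), X k i) ω := by
      ext ω; simp [hS]
    rw [h0, variance_const_mul, IndepFun.variance_sum (fun i _ => hXi k i)
      fun i _ j _ hij => (hindep k).indepFun hij]
    simp only [(hident k _).variance_eq, Finset.sum_const, Finset.card_range, nsmul_eq_mul,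
      inv_pow, Real.sq_sqrt (Nat.cast_nonneg (n k)), ← mul_assoc]
    have hv := variance_nonneg (X k 0) P
    have hle : Var[X k 0; P] ≤ ∫ ω, X k 0 ω ^ 2 ∂P := variance_le_expectation_sq (hX k).1
    by_cases hn : (n k : ℝ) = 0
    · simpa [hn] using integral_nonneg fun ω => sq_nonneg (X k 0 ω)
    · rwa [inv_mul_cancel₀ hn, one_mul]
  have hSsq : ∀ k, ∫ ω, S k ω ^ 2 ∂P = Var[S k; P] + (∫ ω, S k ω ∂P) ^ 2 := by
    intro k
    rw [variance_eq_sub (hSL k)]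
    simp
  -- Variance plus squared bias: the first vanishes by the `L²` hypothesis, the second by `hmean`.
  have hlim : Tendsto (fun k => ∫ ω, S k ω ^ 2 ∂P) atTop (𝓝 0) := by
    have h2 := (tendsto_integral_sq_of_tendsto_eLpNorm hX h).add (hmean.pow 2)
    rw [zero_pow two_ne_zero, add_zero] at h2
    refine squeeze_zero (fun k => integral_nonneg fun ω => sq_nonneg _) (fun k => ?_) h2
    rw [hSsq, hSmean]
    gcongr
    exact hSvar k
  exact tendstoInMeasure_of_tendsto_eLpNorm two_ne_zero (fun k => (hSL k).1)
    aestronglyMeasurable_zero (by simpa using tendsto_eLpNorm_of_tendsto_integral_sq hSL hlim)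

/-- The continuous mapping theorem for convergence in probability to a constant. -/
lemma tendstoInMeasure_comp_of_continuousAt {X : ℕ → Ω → ℝ} {c : ℝ} {g : ℝ → ℝ}
    (hg : ContinuousAt g c) (hX : TendstoInMeasure P X atTop fun _ => c) :
    TendstoInMeasure P (fun k ω => g (X k ω)) atTop fun _ => g c := by
  rw [tendstoInMeasure_iff_dist] at hX ⊢
  intro r hr
  obtain ⟨δ, hδ, h⟩ := Metric.continuousAt_iff.1 hg r hr
  refine tendsto_of_tendsto_of_tendsto_of_le_of_le tendsto_const_nhds (hX δ hδ)
    (fun _ => zero_le) fun k => measure_mono fun ω hω => ?_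
  by_contra hlt
  exact absurd (h (not_le.1 hlt)) (not_lt.2 hω)

lemma tendstoInMeasure_add_zero {X Y : ℕ → Ω → ℝ} {c : ℝ}
    (hX : TendstoInMeasure P X atTop fun _ => c)
    (hY : TendstoInMeasure P Y atTop (0 : Ω → ℝ)) :
    TendstoInMeasure P (fun k ω => X k ω + Y k ω) atTop fun _ => c := by
  rw [tendstoInMeasure_iff_norm] at hX hY ⊢
  intro r hr
  have h := (hX (r / 2) (half_pos hr)).add (hY (r / 2) (half_pos hr))
  rw [add_zero] at h
  refine tendsto_of_tendsto_of_tendsto_of_le_of_le tendsto_const_nhds h (fun _ => zero_le)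
    fun k => (measure_mono fun ω hω => ?_).trans (measure_union_le _ _)
  by_contra hlt
  simp only [Set.mem_union, Set.mem_ofPred_eq, Pi.zero_apply, sub_zero, not_or, not_le] at hlt hω
  have := norm_add_le (X k ω - c) (Y k ω)
  rw [sub_add_eq_add_sub] at this
  linarith [hlt.1, hlt.2]

/-- Variables that differ only where a sequence with nonzero limit in probability vanishes
are asymptotically equal. -/
lemma tendstoInMeasure_zero_of_eq_zero {W D : ℕ → Ω → ℝ} {c : ℝ} (hc : c ≠ 0)
    (hD : TendstoInMeasure P D atTop fun _ => c) (hW : ∀ k ω, D k ω ≠ 0 → W k ω = 0) :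
    TendstoInMeasure P W atTop (0 : Ω → ℝ) := by
  rw [tendstoInMeasure_iff_norm] at hD ⊢
  intro r hr
  refine tendsto_of_tendsto_of_tendsto_of_le_of_le tendsto_const_nhds
    (hD |c| (abs_pos.2 hc)) (fun _ => zero_le) fun k => measure_mono fun ω hω => ?_
  have hD0 : D k ω = 0 := by
    by_contra hne
    simp only [Set.mem_ofPred_eq, hW k ω hne, Pi.zero_apply, sub_zero, norm_zero] at hω
    linarith
  simp [hD0]

/-- The limit variable matters only through its law; this puts the limits produced by Slutsky's
theorem in the form of `id` under a Gaussian measure. -/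
lemma tendstoInDistribution_id_of_map_eq [IsProbabilityMeasure P] {Ω' : Type*}
    [MeasurableSpace Ω'] {P' : Measure Ω'} [IsProbabilityMeasure P'] {X : ℕ → Ω → ℝ} {Z : Ω' → ℝ}
    {ρ : Measure ℝ} [IsProbabilityMeasure ρ]
    (h : TendstoInDistribution X atTop Z (fun _ => P) P') (hρ : P'.map Z = ρ) :
    TendstoInDistribution X atTop (id : ℝ → ℝ) (fun _ => P) ρ where
  forall_aemeasurable := h.forall_aemeasurable
  tendsto := by
    have hlim : (⟨ρ.map id, Measure.isProbabilityMeasure_map aemeasurable_id⟩ :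
        ProbabilityMeasure ℝ) = ⟨P'.map Z, Measure.isProbabilityMeasure_map h.aemeasurable_limit⟩ :=
      Subtype.ext (Measure.map_id.trans hρ.symm)
    exact hlim ▸ h.tendsto

end Convergence

/-! ### Algebraic decomposition of the estimator. -/

section Model

variable {Ω 𝒱 : Type*} {f : 𝒱 → ℝ} {V : ℕ → Ω → 𝒱} {β : ℝ} {ε : ℕ → Ω → ℝ}

/-- The part of `Z * u` that involves prediction errors, for the instrument `z` and the
mismeasured covariate `xhat`. -/
def momentRemainder (f : 𝒱 → ℝ) (V : ℕ → Ω → 𝒱) (β : ℝ) (ε z xhat : ℕ → Ω → ℝ) (i : ℕ) (ω : Ω) :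
    ℝ :=
  predError f V z i ω * ε i ω - β * (f (V i ω) * predError f V xhat i ω)
    - β * (predError f V z i ω * predError f V xhat i ω)

/-- The part of `Z * xhat` that involves prediction errors. -/
def designRemainder (f : 𝒱 → ℝ) (V : ℕ → Ω → 𝒱) (z xhat : ℕ → Ω → ℝ) (i : ℕ) (ω : Ω) : ℝ :=
  f (V i ω) * predError f V xhat i ω + f (V i ω) * predError f V z i ω
    + predError f V z i ω * predError f V xhat i ω

lemma mul_regError (z xhat : ℕ → Ω → ℝ) (i : ℕ) (ω : Ω) :
    z i ω * regError f V β ε xhat i ω = f (V i ω) * ε i ω + momentRemainder f V β ε z xhat i ω := by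
  simp only [regError, outcome, trueVar, momentRemainder, predError]
  ring

lemma sampleMean_mul_eq (n : ℕ) (z xhat : ℕ → Ω → ℝ) (ω : Ω) :
    (n : ℝ)⁻¹ * ∑ i ∈ Finset.range n, z i ω * xhat i ω = sampleSecondMoment f V n ω
      + (n : ℝ)⁻¹ * ∑ i ∈ Finset.range n, designRemainder f V z xhat i ω := by
  rw [sampleSecondMoment, ← mul_add, ← Finset.sum_add_distrib]
  congr 1
  refine Finset.sum_congr rfl fun i _ => ?_
  simp only [designRemainder, predError, trueVar]
  ring

/-- Substituting `Y = xhat * β + u` isolates `β`. The denominator must be nonzero for `β` to cancel: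
the convention `0⁻¹ = 0` would leave `-β` on the left and `0` on the right. -/
lemma sqrt_mul_ivEstimator_sub (n : ℕ) (z xhat : ℕ → Ω → ℝ) (ω : Ω)
    (h : (n : ℝ)⁻¹ * ∑ i ∈ Finset.range n, z i ω * xhat i ω ≠ 0) :
    √(n : ℝ) * (ivEstimator n z xhat (outcome f V β ε) ω - β) =
      ((√(n : ℝ))⁻¹ * ∑ i ∈ Finset.range n, f (V i ω) * ε i ω
        + (√(n : ℝ))⁻¹ * ∑ i ∈ Finset.range n, momentRemainder f V β ε z xhat i ω)
      * ((n : ℝ)⁻¹ * ∑ i ∈ Finset.range n, z i ω * xhat i ω)⁻¹ := by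
  set D := (n : ℝ)⁻¹ * ∑ i ∈ Finset.range n, z i ω * xhat i ω with hD
  have hy : (n : ℝ)⁻¹ * ∑ i ∈ Finset.range n, z i ω * outcome f V β ε i ω
      = (n : ℝ)⁻¹ * (∑ i ∈ Finset.range n, f (V i ω) * ε i ω
        + ∑ i ∈ Finset.range n, momentRemainder f V β ε z xhat i ω) + D * β := by
    rw [hD, mul_assoc, ← mul_add, ← Finset.sum_add_distrib, Finset.sum_mul,
      ← Finset.sum_add_distrib]
    congr 1
    refine Finset.sum_congr rfl fun i _ => ?_
    rw [← mul_regError, regError]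
    ring
  have hs : √(n : ℝ) * (n : ℝ)⁻¹ = (√(n : ℝ))⁻¹ := by
    rw [← div_eq_mul_inv, Real.sqrt_div_self]
  rw [ivEstimator, hy, ← hD, mul_add D⁻¹, inv_mul_cancel_left₀ h, add_sub_cancel_right, ← hs]
  ring

variable [MeasurableSpace Ω] [MeasurableSpace 𝒱] {P : Measure Ω} {M : ℕ}
  {pred : ℕ → Fin M → ℕ → Ω → ℝ} {γ ν σsq : ℝ}

/-! ### Measurability and i.i.d. structure of derived variables. -/

namespace Assumptions

variable (hA : Assumptions P f V ε pred γ ν σsq)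

include hA

lemma measurable_comp_V (i : ℕ) : Measurable fun ω => f (V i ω) :=
  hA.measurable_f.comp (hA.measurable_V i)

lemma measurable_predError (m : ℕ) (j : Fin M) (i : ℕ) :
    Measurable (predError f V (pred m j) i) :=
  (hA.measurable_pred m j i).sub (hA.measurable_comp_V i)

lemma measurable_ivEstimator (n m : ℕ) (a b : Fin M) :
    Measurable (ivEstimator n (pred m b) (pred m a) (outcome f V β ε)) := by
  have hf := hA.measurable_f
  have hV := hA.measurable_V
  have hε := hA.measurable_ε
  have hp := hA.measurable_pred m
  unfold ivEstimator outcome trueVar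
  fun_prop

lemma measurable_sampleSecondMoment (n : ℕ) : Measurable (sampleSecondMoment f V n) := by
  have hf := hA.measurable_f
  have hV := hA.measurable_V
  unfold sampleSecondMoment
  fun_prop

lemma iIndepFun_comp {m : ℕ} (hm : 1 ≤ m) {g : 𝒱 × ℝ × (Fin M → ℝ) → ℝ} (hg : Measurable g) :
    iIndepFun (fun i ω => g (V i ω, ε i ω, fun j => pred m j i ω)) P :=
  (hA.indep m hm).comp (fun _ => g) fun _ => hg

lemma identDistrib_comp {m : ℕ} (hm : 1 ≤ m) {g : 𝒱 × ℝ × (Fin M → ℝ) → ℝ} (hg : Measurable g)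
    (i : ℕ) : IdentDistrib (fun ω => g (V i ω, ε i ω, fun j => pred m j i ω))
      (fun ω => g (V 0 ω, ε 0 ω, fun j => pred m j 0 ω)) P P :=
  (hA.identDistrib m hm i).comp hg

/-- The remainder is a fixed measurable function `g` of the tuple attached to each unit. -/
lemma iIndepFun_momentRemainder {m : ℕ} (hm : 1 ≤ m) (a b : Fin M) :
    iIndepFun (momentRemainder f V β ε (pred m b) (pred m a)) P := by
  have hf := hA.measurable_f
  exact hA.iIndepFun_comp hm (g := fun x => (x.2.2 b - f x.1) * x.2.1
    - β * (f x.1 * (x.2.2 a - f x.1)) - β * ((x.2.2 b - f x.1) * (x.2.2 a - f x.1)))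
    (by fun_prop)

lemma identDistrib_momentRemainder {m : ℕ} (hm : 1 ≤ m) (a b : Fin M) (i : ℕ) :
    IdentDistrib (momentRemainder f V β ε (pred m b) (pred m a) i)
      (momentRemainder f V β ε (pred m b) (pred m a) 0) P P := by
  have hf := hA.measurable_f
  exact hA.identDistrib_comp hm (g := fun x => (x.2.2 b - f x.1) * x.2.1
    - β * (f x.1 * (x.2.2 a - f x.1)) - β * ((x.2.2 b - f x.1) * (x.2.2 a - f x.1)))
    (by fun_prop) i

lemma identDistrib_designRemainder {m : ℕ} (hm : 1 ≤ m) (a b : Fin M) (i : ℕ) :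
    IdentDistrib (designRemainder f V (pred m b) (pred m a) i)
      (designRemainder f V (pred m b) (pred m a) 0) P P := by
  have hf := hA.measurable_f
  exact hA.identDistrib_comp hm (g := fun x => f x.1 * (x.2.2 a - f x.1)
    + f x.1 * (x.2.2 b - f x.1) + (x.2.2 b - f x.1) * (x.2.2 a - f x.1)) (by fun_prop) i

/-! ### Moments implied by the assumptions. -/

variable [IsProbabilityMeasure P]

lemma memLp_comp_V (i : ℕ) : MemLp (fun ω => f (V i ω)) 2 P := by
  obtain ⟨C, hC⟩ := hA.bounded_f
  exact MemLp.of_bound (hA.measurable_comp_V i).aestronglyMeasurable C (hC i)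

omit [IsProbabilityMeasure P] in
lemma memLp_comp_V_mul {X : Ω → ℝ} (hX : MemLp X 2 P) (i : ℕ) :
    MemLp (fun ω => f (V i ω) * X ω) 2 P := by
  obtain ⟨C, hC⟩ := hA.bounded_f
  refine hX.of_le_mul (c := C) ((hA.measurable_comp_V i).aestronglyMeasurable.mul hX.1) ?_
  filter_upwards [hC i] with ω hω
  rw [norm_mul]
  gcongr
  exact hω

/-- Nonnegativity of the variance gives `E[f²] ≥ E[f]²`, and the mean is nonzero. -/
lemma secondMoment_pos : 0 < ∫ ω, f (V 0 ω) ^ 2 ∂P := by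
  have h1 := variance_nonneg (fun ω => f (V 0 ω)) P
  rw [variance_eq_sub (hA.memLp_comp_V 0)] at h1
  have h2 : 0 < (∫ ω, f (V 0 ω) ∂P) ^ 2 := by
    have := hA.mean_ne_zero
    positivity
  simp only [Pi.pow_apply] at h1
  linarith

lemma ae_tendsto_sampleSecondMoment :
    ∀ᵐ ω ∂P, Tendsto (fun n => sampleSecondMoment f V n ω) atTop
      (𝓝 (∫ ω, f (V 0 ω) ^ 2 ∂P)) := by
  have hf := hA.measurable_f
  have hg : Measurable fun x : 𝒱 × ℝ × (Fin M → ℝ) => f x.1 ^ 2 := by fun_prop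
  -- `f (V i)` does not involve the training size, so the i.i.d. assumption at size `1` suffices.
  have h := strong_law_ae_real (fun i ω => f (V i ω) ^ 2) (hA.memLp_comp_V 0).integrable_sq
    (fun i j hij => (hA.iIndepFun_comp le_rfl hg).indepFun hij)
    (hA.identDistrib_comp le_rfl hg)
  filter_upwards [h] with ω hω
  simpa only [sampleSecondMoment, inv_mul_eq_div] using hω

lemma integral_predError {m : ℕ} (hm : 1 ≤ m) (j : Fin M) :
    ∫ ω, predError f V (pred m j) 0 ω ∂P = 0 :=
  integral_eq_of_condExp_eq_const (hA.measurable_V 0).comap_le (hA.error_mean m hm j 0)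

omit [IsProbabilityMeasure P] in
lemma comap_trueVar_le (i : ℕ) :
    MeasurableSpace.comap (trueVar f V i) inferInstance ≤ ‹MeasurableSpace Ω› :=
  (hA.measurable_comp_V i).comap_le

lemma integral_noise : ∫ ω, ε 0 ω ∂P = 0 :=
  integral_eq_of_condExp_eq_const (hA.comap_trueVar_le 0) (hA.noise_mean 0)

lemma sigma_nonneg : 0 ≤ σsq := by
  rw [← integral_eq_of_condExp_eq_const (hA.comap_trueVar_le 0) (hA.noise_sq_mean 0)]
  exact integral_nonneg fun ω => sq_nonneg _

lemma integral_signal_mul_noise : ∫ ω, f (V 0 ω) * ε 0 ω ∂P = 0 := by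
  have h := integral_mul_of_condExp_eq_const (hA.comap_trueVar_le 0) (X := trueVar f V 0)
    (c := 0)
    (comap_measurable _).stronglyMeasurable
    ((hA.memLp_comp_V_mul (hA.memLp_ε 0) 0).integrable (by norm_num))
    ((hA.memLp_ε 0).integrable (by norm_num)) (hA.noise_mean 0)
  simpa [trueVar] using h

/-- The mean is zero, and `f²` is a function of `X`, so conditioning on `X` replaces `ε²` by `σsq`.
-/
lemma variance_signal_mul_noise :
    Var[fun ω => f (V 0 ω) * ε 0 ω; P] = σsq * ∫ ω, f (V 0 ω) ^ 2 ∂P := by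
  have hL := hA.memLp_comp_V_mul (hA.memLp_ε 0) 0
  rw [variance_eq_sub hL, hA.integral_signal_mul_noise]
  have h := integral_mul_of_condExp_eq_const (hA.comap_trueVar_le 0)
    (X := fun ω => trueVar f V 0 ω ^ 2) (Y := fun ω => ε 0 ω ^ 2)
    ((comap_measurable (trueVar f V 0)).pow_const 2).stronglyMeasurable
    (by
      refine hL.integrable_sq.congr (Eventually.of_forall fun ω => ?_)
      exact mul_pow _ _ _)
    (hA.memLp_ε 0).integrable_sq (hA.noise_sq_mean 0)
  simp only [trueVar, ← mul_pow] at h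
  simpa using h

/-- As `u` is centered, the covariance is `E[Z u]`, and the summand `f ε` of `Z u` has mean zero.
This turns the exclusion condition into a bound on the bias of the remainder. -/
lemma covariance_instrument_regError {m : ℕ} (hm : 1 ≤ m) {a b : Fin M}
    (hR : MemLp (momentRemainder f V β ε (pred m b) (pred m a) 0) 2 P) :
    cov[pred m b 0, regError f V β ε (pred m a) 0; P]
      = ∫ ω, momentRemainder f V β ε (pred m b) (pred m a) 0 ω ∂P := by
  have hz : MemLp (pred m b 0) 2 P := by
    have := (hA.memLp_comp_V 0).add (hA.memLp_error m hm b 0)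
    refine this.ae_eq (Eventually.of_forall fun ω => ?_)
    simp [predError, trueVar]
  have hueq : regError f V β ε (pred m a) 0
      = fun ω => ε 0 ω - β * predError f V (pred m a) 0 ω := by
    ext ω
    simp only [regError, outcome, predError]
    ring
  have hea := hA.memLp_error m hm a 0
  have hu : MemLp (regError f V β ε (pred m a) 0) 2 P := by
    rw [hueq]
    exact (hA.memLp_ε 0).sub (hea.const_mul β)
  have humean : ∫ ω, regError f V β ε (pred m a) 0 ω ∂P = 0 := by
    rw [hueq, integral_sub ((hA.memLp_ε 0).integrable (by norm_num))
      ((hea.const_mul β).integrable (by norm_num)), integral_const_mul,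
      hA.integral_predError hm, hA.integral_noise]
    simp
  rw [covariance_eq_sub hz hu, humean, mul_zero, sub_zero]
  simp only [Pi.mul_apply, mul_regError]
  rw [integral_add ((hA.memLp_comp_V_mul (hA.memLp_ε 0) 0).integrable (by norm_num))
    (hR.integrable (by norm_num)), hA.integral_signal_mul_noise, zero_add]

/-! ### The remainders vanish in `L²` as the training size grows. -/

variable {N : ℕ → ℕ} (hN1 : ∀ k, 1 ≤ N k) (hN : Tendsto N atTop atTop)

include hN1 hN

lemma tendsto_eLpNorm_predError (j : Fin M) :
    Tendsto (fun k => eLpNorm (predError f V (pred (N k) j) 0) 2 P) atTop (𝓝 0) := by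
  refine tendsto_eLpNorm_of_tendsto_integral_sq (fun k => hA.memLp_error _ (hN1 k) j 0) ?_
  obtain ⟨C₂, hC₂⟩ := hA.error_var
  have h1 : ∀ k, ∫ ω, predError f V (pred (N k) j) 0 ω ^ 2 ∂P = C₂ j / (N k : ℝ) ^ γ := fun k =>
    integral_eq_of_condExp_eq_const (hA.measurable_V 0).comap_le (hC₂ _ (hN1 k) j 0)
  simp_rw [h1]
  exact ((tendsto_rpow_atTop hA.gamma_pos).comp
    (tendsto_natCast_atTop_atTop.comp hN)).const_div_atTop _

lemma tendsto_eLpNorm_comp_V_mul_predError (j : Fin M) :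
    Tendsto (fun k => eLpNorm (fun ω => f (V 0 ω) * predError f V (pred (N k) j) 0 ω) 2 P)
      atTop (𝓝 0) := by
  obtain ⟨C, hC⟩ := hA.bounded_f
  have h := ENNReal.Tendsto.const_mul (hA.tendsto_eLpNorm_predError hN1 hN j)
    (.inr (ENNReal.ofReal_ne_top (r := C)))
  rw [mul_zero] at h
  refine tendsto_of_tendsto_of_tendsto_of_le_of_le tendsto_const_nhds h (fun _ => zero_le)
    fun k => eLpNorm_le_mul_eLpNorm_of_ae_le_mul ?_ 2
  filter_upwards [hC 0] with ω hω
  rw [norm_mul]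
  gcongr
  exact hω

variable {a b : Fin M}
  (hUI_error : UniformIntegrable (fun (m : ℕ+) ω =>
    predError f V (pred m b) 0 ω * predError f V (pred m a) 0 ω) 2 P)

include hUI_error

omit hA hN hN1 [IsProbabilityMeasure P] [MeasurableSpace 𝒱] in
lemma memLp_mul_error {m : ℕ} (hm : 1 ≤ m) :
    MemLp (fun ω => predError f V (pred m b) 0 ω * predError f V (pred m a) 0 ω) 2 P :=
  hUI_error.memLp (⟨m, hm⟩ : ℕ+)

lemma tendsto_eLpNorm_error_mul_error :
    Tendsto (fun k => eLpNorm (fun ω => predError f V (pred (N k) b) 0 ω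
      * predError f V (pred (N k) a) 0 ω) 2 P) atTop (𝓝 0) := by
  refine tendsto_eLpNorm_mul_of_unifIntegrable
    (fun k => (hA.measurable_predError _ _ _).aestronglyMeasurable)
    (fun k => (hA.measurable_predError _ _ _).aestronglyMeasurable) ?_
    -- Uniform integrability over all training sizes passes to the sequence `N k`, with the same
    -- `δ`.
    fun r hr => by
        obtain ⟨δ, hδ, h⟩ := hUI_error.unifIntegrable hr
        exact ⟨δ, hδ, fun k => h ⟨N k, hN1 k⟩⟩
  simpa using ENNReal.Tendsto.mul (hA.tendsto_eLpNorm_predError hN1 hN b)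
    (.inr ENNReal.zero_ne_top) (hA.tendsto_eLpNorm_predError hN1 hN a) (.inr ENNReal.zero_ne_top)

lemma tendsto_eLpNorm_designRemainder :
    Tendsto (fun k => eLpNorm (designRemainder f V (pred (N k) b) (pred (N k) a) 0) 2 P)
      atTop (𝓝 0) := by
  have h := ((hA.tendsto_eLpNorm_comp_V_mul_predError hN1 hN a).add
    (hA.tendsto_eLpNorm_comp_V_mul_predError hN1 hN b)).add
    (hA.tendsto_eLpNorm_error_mul_error hN1 hN hUI_error)
  rw [add_zero, add_zero] at h
  refine tendsto_of_tendsto_of_tendsto_of_le_of_le tendsto_const_nhds h (fun _ => zero_le)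
    fun k => ?_
  have ha := (hA.memLp_comp_V_mul (hA.memLp_error _ (hN1 k) a 0) 0).1
  have hb := (hA.memLp_comp_V_mul (hA.memLp_error _ (hN1 k) b 0) 0).1
  have hab := (memLp_mul_error hUI_error (hN1 k)).1
  exact (eLpNorm_add_le (ha.add hb) hab (by norm_num)).trans
    (add_le_add_left (eLpNorm_add_le ha hb (by norm_num)) _)

variable (hUI_noise : UniformIntegrable (fun (m : ℕ+) ω =>
    predError f V (pred m b) 0 ω * ε 0 ω) 2 P)

include hUI_noise

omit hN [IsProbabilityMeasure P] in
lemma memLp_momentRemainder (k : ℕ) :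
    MemLp (momentRemainder f V β ε (pred (N k) b) (pred (N k) a) 0) 2 P :=
  ((hUI_noise.memLp (⟨N k, hN1 k⟩ : ℕ+)).sub
    ((hA.memLp_comp_V_mul (hA.memLp_error _ (hN1 k) a 0) 0).const_mul β)).sub
    ((memLp_mul_error hUI_error (hN1 k)).const_mul β)

lemma tendsto_eLpNorm_momentRemainder :
    Tendsto (fun k => eLpNorm (momentRemainder f V β ε (pred (N k) b) (pred (N k) a) 0) 2 P)
      atTop (𝓝 0) := by
  have h0 : Tendsto (fun k => eLpNorm (fun ω => predError f V (pred (N k) b) 0 ω * ε 0 ω) 2 P)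
      atTop (𝓝 0) := by
    -- Here only one factor vanishes; the other is fixed in `L²`, which is enough for Hölder.
    refine tendsto_eLpNorm_mul_of_unifIntegrable (Y := fun _ => ε 0)
      (fun k => (hA.measurable_predError _ _ _).aestronglyMeasurable)
      (fun k => (hA.measurable_ε 0).aestronglyMeasurable) ?_
      fun r hr => by
        obtain ⟨δ, hδ, h⟩ := hUI_noise.unifIntegrable hr
        exact ⟨δ, hδ, fun k => h ⟨N k, hN1 k⟩⟩
    simpa using ENNReal.Tendsto.mul_const (hA.tendsto_eLpNorm_predError hN1 hN b)
      (.inr (hA.memLp_ε 0).2.ne)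
  have h := (h0.add (ENNReal.Tendsto.const_mul
    (hA.tendsto_eLpNorm_comp_V_mul_predError hN1 hN a) (.inr (enorm_ne_top (x := β))))).add
    (ENNReal.Tendsto.const_mul
      (hA.tendsto_eLpNorm_error_mul_error hN1 hN hUI_error) (.inr (enorm_ne_top (x := β))))
  rw [mul_zero, add_zero, add_zero] at h
  refine tendsto_of_tendsto_of_tendsto_of_le_of_le tendsto_const_nhds h (fun _ => zero_le)
    fun k => ?_
  have h1 := (hUI_noise.memLp (⟨N k, hN1 k⟩ : ℕ+)).1
  have h2 := (hA.memLp_comp_V_mul (hA.memLp_error _ (hN1 k) a 0) 0).1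
  have h3 := (memLp_mul_error hUI_error (hN1 k)).1
  have e2 := eLpNorm_const_smul β
    (fun ω => f (V 0 ω) * predError f V (pred (N k) a) 0 ω) 2 P
  have e3 := eLpNorm_const_smul β
    (fun ω => predError f V (pred (N k) b) 0 ω * predError f V (pred (N k) a) 0 ω) 2 P
  dsimp only
  rw [← e2, ← e3]
  exact (eLpNorm_sub_le (h1.sub (h2.const_smul β)) (h3.const_smul β) (by norm_num)).trans
    (add_le_add_left (eLpNorm_sub_le h1 (h2.const_smul β) (by norm_num)) _)

/-! ### The limit theorem for positive training sizes. -/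

variable {n : ℕ → ℕ} (hn : Tendsto n atTop atTop)

include hn

-- The strong law handles `f²`; the remainder needs only its `L¹` norm to vanish, with no
-- independence across units.
omit hUI_noise in
lemma tendstoInMeasure_sampleMean_mul :
    TendstoInMeasure P (fun k ω => (n k : ℝ)⁻¹ * ∑ i ∈ Finset.range (n k),
      pred (N k) b i ω * pred (N k) a i ω) atTop fun _ => ∫ ω, f (V 0 ω) ^ 2 ∂P := by
  have h1 : TendstoInMeasure P (fun k => sampleSecondMoment f V (n k)) atTop
      fun _ => ∫ ω, f (V 0 ω) ^ 2 ∂P := by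
    refine tendstoInMeasure_of_tendsto_ae
      (fun k => (hA.measurable_sampleSecondMoment _).aestronglyMeasurable) ?_
    filter_upwards [hA.ae_tendsto_sampleSecondMoment] with ω hω using hω.comp hn
  have hmeas : ∀ k i, AEStronglyMeasurable
      (designRemainder f V (pred (N k) b) (pred (N k) a) i) P := fun k i =>
    (hA.identDistrib_designRemainder (hN1 k) a b i).aemeasurable_fst.aestronglyMeasurable
  have h2 := tendstoInMeasure_sampleMean_zero (n := n) hmeas
    (fun k i => (hA.identDistrib_designRemainder (hN1 k) a b i).eLpNorm_eq 1)
    (tendsto_of_tendsto_of_tendsto_of_le_of_le tendsto_const_nhds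
      (hA.tendsto_eLpNorm_designRemainder hN1 hN hUI_error) (fun _ => zero_le)
      fun k => eLpNorm_le_eLpNorm_of_exponent_le (by norm_num) (hmeas k 0))
  simpa only [← sampleMean_mul_eq] using tendstoInMeasure_add_zero h1 h2

omit hN hN1 hUI_error hUI_noise in
lemma tendstoInDistribution_signal_mul_noise :
    TendstoInDistribution
      (fun k ω => (√(n k : ℝ))⁻¹ * ∑ i ∈ Finset.range (n k), f (V i ω) * ε i ω) atTop
      (id : ℝ → ℝ) (fun _ => P) (gaussianReal 0 (σsq * ∫ ω, f (V 0 ω) ^ 2 ∂P).toNNReal) := by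
  have hf := hA.measurable_f
  have hg : Measurable fun x : 𝒱 × ℝ × (Fin M → ℝ) => f x.1 * x.2.1 := by fun_prop
  have h := tendstoInDistribution_inv_sqrt_mul_sum_sub (P := P)
    (X := fun i ω => f (V i ω) * ε i ω)
    (P' := gaussianReal 0 (σsq * ∫ ω, f (V 0 ω) ^ 2 ∂P).toNNReal) (Y := id)
    (by rw [hA.variance_signal_mul_noise]; exact HasLaw.id)
    (hA.memLp_comp_V_mul (hA.memLp_ε 0) 0)
    (hA.iIndepFun_comp le_rfl hg) (hA.identDistrib_comp le_rfl hg)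
  simp only [hA.integral_signal_mul_noise, mul_zero, sub_zero] at h
  exact ⟨fun k => h.forall_aemeasurable (n k), h.aemeasurable_limit, h.tendsto.comp hn⟩

theorem tendstoInDistribution_ivEstimator_of_one_le
    (hexcl : Tendsto (fun k => √(n k : ℝ) *
      cov[pred (N k) b 0, regError f V β ε (pred (N k) a) 0; P]) atTop (𝓝 0)) :
    TendstoInDistribution
      (fun k ω => √(n k : ℝ) *
        (ivEstimator (n k) (pred (N k) b) (pred (N k) a) (outcome f V β ε) ω - β))
      atTop (id : ℝ → ℝ) (fun _ => P)
      (gaussianReal 0 (σsq / ∫ ω, f (V 0 ω) ^ 2 ∂P).toNNReal) := by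
  have hpos := hA.secondMoment_pos
  have hsig := hA.sigma_nonneg
  set D : ℕ → Ω → ℝ := fun k ω => (n k : ℝ)⁻¹ * ∑ i ∈ Finset.range (n k),
    pred (N k) b i ω * pred (N k) a i ω with hD
  have hDm : ∀ k, Measurable (D k) := by
    intro k
    have := hA.measurable_pred
    fun_prop
  have hDlim := hA.tendstoInMeasure_sampleMean_mul hN1 hN hUI_error hn
  have hRL := hA.memLp_momentRemainder (β := β) hN1 hUI_error hUI_noise
  have hRlim := tendstoInMeasure_inv_sqrt_mul_sum_zero (n := n) hRL
    (fun k => hA.iIndepFun_momentRemainder (hN1 k) a b)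
    (fun k i => hA.identDistrib_momentRemainder (hN1 k) a b i)
    (hA.tendsto_eLpNorm_momentRemainder hN1 hN hUI_error hUI_noise)
    -- The scaled mean of the remainder is the scaled covariance of the exclusion condition.
    (by simpa only [hA.covariance_instrument_regError (hN1 _) (hRL _)] using hexcl)
  have hRm : ∀ k, AEMeasurable (fun ω => (√(n k : ℝ))⁻¹ * ∑ i ∈ Finset.range (n k),
      momentRemainder f V β ε (pred (N k) b) (pred (N k) a) i ω) P := fun k =>
    (Finset.aemeasurable_fun_sum _ fun i _ =>
      (hA.identDistrib_momentRemainder (hN1 k) a b i).aemeasurable_fst).const_mul _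
  have hnum := (hA.tendstoInDistribution_signal_mul_noise hn).add_of_tendstoInMeasure_const
    (c := 0) hRlim hRm
  -- Division is not globally continuous, so the inverse is first taken in probability, at its
  -- nonzero limit, and Slutsky is applied to the product.
  have hratio := hnum.continuous_comp_prodMk_of_tendstoInMeasure_const (g := fun x => x.1 * x.2)
    (by fun_prop) (tendstoInMeasure_comp_of_continuousAt (continuousAt_inv₀ hpos.ne') hDlim)
    fun k => (hDm k).inv.aemeasurable
  have hlaw := tendstoInDistribution_id_of_map_eq hratio
    (ρ := gaussianReal 0 (σsq / ∫ ω, f (V 0 ω) ^ 2 ∂P).toNNReal) (by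
      simp only [id, add_zero]
      rw [gaussianReal_map_mul_const, mul_zero]
      congr 1
      ext
      rw [NNReal.coe_mul, Real.coe_toNNReal _ (by positivity), Real.coe_toNNReal _ (by positivity)]
      simp only [NNReal.coe_mk]
      field_simp)
  -- The estimator agrees with the ratio wherever the denominator is nonzero, hence with probability
  -- tending to one.
  refine tendstoInDistribution_of_tendstoInMeasure_sub _ _ hlaw
    (tendstoInMeasure_zero_of_eq_zero hpos.ne' hDlim fun k ω hne => ?_)
    fun k => (((hA.measurable_ivEstimator _ _ _ _).sub_const _).const_mul _).aemeasurable
  simp only [Pi.sub_apply, Pi.add_apply]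
  rw [sqrt_mul_ivEstimator_sub _ _ _ _ hne, sub_self]

end Assumptions

end Model

/-- If the test fraction of a split converges to a limit below one and the total size diverges,
then so does the training size. -/
lemma tendsto_atTop_of_split {nl nt ntr : ℕ → ℕ} {ψ : ℝ} (hψ : ψ < 1)
    (hsplit : ∀ k, nt k + ntr k = nl k)
    (hratio : Tendsto (fun k => (nt k : ℝ) / (nl k : ℝ)) atTop (𝓝 ψ))
    (hnl : Tendsto nl atTop atTop) : Tendsto ntr atTop atTop := by
  have h1 : Tendsto (fun k => (1 - (nt k : ℝ) / (nl k : ℝ)) * nl k) atTop atTop :=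
    (hratio.const_sub 1).pos_mul_atTop (sub_pos.2 hψ) (tendsto_natCast_atTop_atTop.comp hnl)
  refine (tendsto_natCast_atTop_iff (R := ℝ)).1 (h1.congr' ?_)
  filter_upwards [hnl.eventually_ge_atTop 1] with k hk
  have hk0 : (nl k : ℝ) ≠ 0 := by positivity
  have hs : (nt k : ℝ) + ntr k = nl k := mod_cast hsplit k
  field_simp
  linarith

lemma tendstoInDistribution_congr_eventually {Ω Ω' : Type*} [MeasurableSpace Ω]
    [MeasurableSpace Ω'] {P : Measure Ω} [IsProbabilityMeasure P] {P' : Measure Ω'}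
    [IsProbabilityMeasure P'] {X Y : ℕ → Ω → ℝ} {Z : Ω' → ℝ}
    (h : TendstoInDistribution X atTop Z (fun _ => P) P') (hXY : ∀ᶠ k in atTop, X k = Y k)
    (hY : ∀ k, AEMeasurable (Y k) P) : TendstoInDistribution Y atTop Z (fun _ => P) P' := by
  refine tendstoInDistribution_of_tendstoInMeasure_sub _ _ h ?_ hY
  refine TendstoInMeasure.congr' (f := fun _ => (0 : Ω → ℝ)) ?_ ae_eq_rfl
    fun r hr => by simp [not_le.2 hr]
  filter_upwards [hXY] with k hk
  simp [hk]

/-! ### Arbitrary diverging training sizes. -/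

namespace Assumptions

variable {Ω 𝒱 : Type*} [MeasurableSpace Ω] [MeasurableSpace 𝒱] {P : Measure Ω}
  [IsProbabilityMeasure P] {M : ℕ} {f : 𝒱 → ℝ} {V : ℕ → Ω → 𝒱} {β : ℝ} {ε : ℕ → Ω → ℝ}
  {pred : ℕ → Fin M → ℕ → Ω → ℝ} {γ ν σsq : ℝ}

/-- The assumptions say nothing at training size `0`, which a diverging sequence may take finitely
often; replacing `N k` by `max (N k) 1` leaves the limit unchanged. -/
theorem tendstoInDistribution_ivEstimator (hA : Assumptions P f V ε pred γ ν σsq) {a b : Fin M}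
    (hUI_error : UniformIntegrable (fun (m : ℕ+) ω =>
      predError f V (pred m b) 0 ω * predError f V (pred m a) 0 ω) 2 P)
    (hUI_noise : UniformIntegrable (fun (m : ℕ+) ω => predError f V (pred m b) 0 ω * ε 0 ω) 2 P)
    {n N : ℕ → ℕ} (hn : Tendsto n atTop atTop) (hN : Tendsto N atTop atTop)
    (hexcl : Tendsto (fun k => √(n k : ℝ) *
      cov[pred (N k) b 0, regError f V β ε (pred (N k) a) 0; P]) atTop (𝓝 0)) :
    TendstoInDistribution
      (fun k ω => √(n k : ℝ) *
        (ivEstimator (n k) (pred (N k) b) (pred (N k) a) (outcome f V β ε) ω - β))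
      atTop (id : ℝ → ℝ) (fun _ => P)
      (gaussianReal 0 (σsq / ∫ ω, f (V 0 ω) ^ 2 ∂P).toNNReal) := by
  have hev : ∀ᶠ k in atTop, max (N k) 1 = N k := by
    filter_upwards [hN.eventually_ge_atTop 1] with k hk using max_eq_left hk
  have h := hA.tendstoInDistribution_ivEstimator_of_one_le (β := β) (N := fun k => max (N k) 1)
    (fun k => le_max_right _ _) (tendsto_atTop_mono (fun k => le_max_left _ _) hN)
    hUI_error hUI_noise hn (hexcl.congr' (hev.mono fun k hk => by simp only [hk]))
  exact tendstoInDistribution_congr_eventually h (hev.mono fun k hk => by simp only [hk])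
    fun k => (((hA.measurable_ivEstimator _ _ _ _).sub_const _).const_mul _).aemeasurable

end Assumptions

end EnsembleIV

theorem theorem1 {Ω 𝒱 : Type*} [MeasurableSpace Ω] [MeasurableSpace 𝒱]
    (P : Measure Ω) [IsProbabilityMeasure P] {M : ℕ}
    (f : 𝒱 → ℝ) (V : ℕ → Ω → 𝒱) (β : ℝ) (ε : ℕ → Ω → ℝ)
    (pred : ℕ → Fin M → ℕ → Ω → ℝ) (γ ν σsq : ℝ)
    (hA : EnsembleIV.Assumptions P f V ε pred γ ν σsq)
    -- model `a` gives the mismeasured covariate, model `b` the instrument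
    (a b : Fin M) (hab : a ≠ b)
    -- the squares of `e_b * e_a` and of `e_b * ε` are uniformly integrable in the training size
    (hUI_error : UniformIntegrable (fun (m : ℕ+) ω =>
      EnsembleIV.predError f V (pred m b) 0 ω * EnsembleIV.predError f V (pred m a) 0 ω) 2 P)
    (hUI_noise : UniformIntegrable (fun (m : ℕ+) ω =>
      EnsembleIV.predError f V (pred m b) 0 ω * ε 0 ω) 2 P)
    -- sizes of the unlabeled, labeled, test and training data
    (nu nl nt ntr : ℕ → ℕ) (ψ : ℝ) (hψ : ψ ∈ Set.Ioo (0 : ℝ) 1)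
    (hsplit : ∀ k, nt k + ntr k = nl k)
    (hratio : Tendsto (fun k => (nt k : ℝ) / (nl k : ℝ)) atTop (𝓝 ψ))
    (hnu : Tendsto nu atTop atTop) (hnl : Tendsto nl atTop atTop)
    -- the instrument asymptotically meets the exclusion condition `Cov(Z, u) = 0`, at the scale of the estimator
    (hexcl : Tendsto (fun k => √(nu k : ℝ) *
      cov[pred (ntr k) b 0, EnsembleIV.regError f V β ε (pred (ntr k) a) 0; P]) atTop (𝓝 0)) :
    0 < ∫ ω, f (V 0 ω) ^ 2 ∂P ∧
    (∀ᵐ ω ∂P, Tendsto (fun k => EnsembleIV.sampleSecondMoment f V (nu k) ω) atTop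
      (𝓝 (∫ ω, f (V 0 ω) ^ 2 ∂P))) ∧
    TendstoInDistribution
      (fun k ω => √(nu k : ℝ) *
        (EnsembleIV.ivEstimator (nu k) (pred (ntr k) b) (pred (ntr k) a)
          (EnsembleIV.outcome f V β ε) ω - β))
      atTop (id : ℝ → ℝ) (fun _ => P)
      (gaussianReal 0 (σsq / ∫ ω, f (V 0 ω) ^ 2 ∂P).toNNReal) ∧
    TendstoInDistribution
      (fun k ω => √(EnsembleIV.sampleSecondMoment f V (nu k) ω) * (√(nu k : ℝ) *
        (EnsembleIV.ivEstimator (nu k) (pred (ntr k) b) (pred (ntr k) a)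
          (EnsembleIV.outcome f V β ε) ω - β)))
      atTop (id : ℝ → ℝ) (fun _ => P) (gaussianReal 0 σsq.toNNReal) := by
  have hpos := hA.secondMoment_pos
  have hsig := hA.sigma_nonneg
  have hlim : ∀ᵐ ω ∂P, Tendsto (fun k => EnsembleIV.sampleSecondMoment f V (nu k) ω) atTop
      (𝓝 (∫ ω, f (V 0 ω) ^ 2 ∂P)) := by
    filter_upwards [hA.ae_tendsto_sampleSecondMoment] with ω hω using hω.comp hnu
  have hCLT := hA.tendstoInDistribution_ivEstimator hUI_error hUI_noise hnu
    (EnsembleIV.tendsto_atTop_of_split hψ.2 hsplit hratio hnl) hexcl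
  have hm : ∀ k, Measurable (EnsembleIV.sampleSecondMoment f V (nu k)) := fun k =>
    hA.measurable_sampleSecondMoment _
  have hsqrt : TendstoInMeasure P (fun k ω => √(EnsembleIV.sampleSecondMoment f V (nu k) ω)) atTop
      fun _ => √(∫ ω, f (V 0 ω) ^ 2 ∂P) :=
    EnsembleIV.tendstoInMeasure_comp_of_continuousAt Real.continuous_sqrt.continuousAt
      (tendstoInMeasure_of_tendsto_ae (fun k => (hm k).aestronglyMeasurable) hlim)
  -- Slutsky with the factor `√E[f²]`, which rescales the limiting variance to `σsq`.
  have hstud := hCLT.continuous_comp_prodMk_of_tendstoInMeasure_const (g := fun x => x.2 * x.1)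
    (by fun_prop) hsqrt fun k => (hm k).sqrt.aemeasurable
  refine ⟨hpos, hlim, hCLT, EnsembleIV.tendstoInDistribution_id_of_map_eq hstud ?_⟩
  simp only [id]
  rw [gaussianReal_map_const_mul, mul_zero]
  congr 1
  ext
  rw [NNReal.coe_mul, Real.coe_toNNReal _ (by positivity), Real.coe_toNNReal _ hsig]
  simp only [NNReal.coe_mk]
  rw [Real.sq_sqrt hpos.le]
  field_simp
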